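/- Let $k\ge 3$ be an integer. The harmonic function $f_k:[0,1]\to[0,1]$ is defined by $f_k(x)=1/q$ for $x\in(\frac1{q+1},\frac1q]$, $q\in\{1,\dots,k-1\}$, and $f_k(x)=\frac{k}{k-2}x$ for $x\le\frac1k$. A function $g:[0,1]\to[0,1]$ is a weighting function if $\sum_{i=1}^m g(x_i)\le 1$ for all $m\ge 1$ and all $x\in[0,1]^m$ with $\sum_{i=1}^m x_i\le 1$. Let $T_k$ be the smallest positive constant such that $f_k/T_k$ is a weighting function. Let $d\ge 2$ and let $I$ be a finite collection of $d$-dimensional axis-parallel boxes (items), item $i$ having side lengths $\ell_1(i),\dots,\ell_d(i)\in(0,1]$. Let $\mathrm{opt}_{d\mathrm{BP}}(I)$ be the minimum number of $d$-dimensional unit cubes into which $I$ can be packed by translations, without rotation and without overlap. Let $\mathrm{round}(I)$ be the collection of rectangles obtained by replacing each item $i$ by a rectangle of width $\prod_{j=1}^{d-1}f_k(\ell_j(i))$ and height $\ell_d(i)$. Let $\delta\in(0,1)$ and let $K$ be a finite collection of rectangles. A rectangle of $K$ is $\delta$-large if its height exceeds $\delta$, and $\delta$-small otherwise. A shelf is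 a rectangle of width $1$. A shelf-based $\delta$-fractional packing of $K$ into $N$ bins (unit squares) consists of finitely many shelves packed into the bins without overlap, together with a non-overlapping axis-parallel packing (without rotation) of all of $K$ into the bins, where each $\delta$-large rectangle may first be cut recursively (finitely often) by vertical cuts, each $\delta$-small rectangle may first be cut recursively (finitely often) by vertical and horizontal cuts, every slice of a $\delta$-large rectangle lies inside a shelf with its bottom edge on the bottom edge of the shelf, and no slice of a $\delta$-small rectangle overlaps a shelf. The packing is structured if its shelves have at most $\lceil 1/\delta^2\rceil$ distinct heights and each shelf height is the height of some $\delta$-large rectangle of $K$. Let $\mathrm{sopt}_\delta(K)$ be the minimum number of bins in a structured $\delta$-fractional packing of $K$. Then $\mathrm{round}(I)$ has a structured $\delta$-fractional packing, and $$\mathrm{sopt}_\delta(\mathrm{round}(I)) < T_k^{d-1}(1+\delta)\,\mathrm{opt}_{d\mathrm{BP}}(I)+\lceil 1/\delta^2\rceil+1+\delta .$$ -/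

import Mathlib

/-! ### Harmonic rounding and weighting functions -/

/-- The harmonic function `f_k`: on `[0, 1]` it is `k / (k - 2) * x` for `x ≤ 1 / k`, and it is
`1 / q` on `(1 / (q + 1), 1 / q]` for `q = 1, …, k - 1` (there `⌊1 / x⌋ = q`). -/
noncomputable def harmonicFn (k : ℕ) (x : ℝ) : ℝ :=
  if x ≤ 1 / (k : ℝ) then (k : ℝ) / ((k : ℝ) - 2) * x else 1 / (⌊1 / x⌋₊ : ℝ)

theorem harmonicFn_of_mem_Ioc {k q : ℕ} (hq : 1 ≤ q) (hqk : q < k) {x : ℝ}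
    (hx : x ∈ Set.Ioc (1 / ((q : ℝ) + 1)) (1 / (q : ℝ))) : harmonicFn k x = 1 / (q : ℝ) := by
  have hq0 : (0 : ℝ) < q := by exact_mod_cast hq
  have hx0 : 0 < x := lt_trans (by positivity) hx.1
  have hkx : 1 / (k : ℝ) < x := by
    refine lt_of_le_of_lt ?_ hx.1
    have h : (q : ℝ) + 1 ≤ k := by exact_mod_cast hqk
    exact one_div_le_one_div_of_le (by positivity) h
  have hfl : ⌊1 / x⌋₊ = q := by
    rw [Nat.floor_eq_iff (by positivity)]
    constructor
    · rw [le_div_iff₀ hx0]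
      have := hx.2
      rw [le_div_iff₀ hq0] at this
      linarith
    · rw [div_lt_iff₀ hx0]
      have := hx.1
      rw [div_lt_iff₀ (by positivity)] at this
      linarith
  rw [harmonicFn, if_neg (not_le.mpr hkx), hfl]

/-- Weighting functions (dual feasible functions) `[0, 1] → [0, 1]`. -/
def IsWeightingFunction (g : ℝ → ℝ) : Prop :=
  (∀ x ∈ Set.Icc (0 : ℝ) 1, g x ∈ Set.Icc (0 : ℝ) 1) ∧
    ∀ (m : ℕ) (x : Fin m → ℝ), 0 < m → (∀ i, x i ∈ Set.Icc (0 : ℝ) 1) →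
      ∑ i, x i ≤ 1 → ∑ i, g (x i) ≤ 1

/-- `T_k`: the smallest positive constant `c` such that `f_k / c` is a weighting function. -/
noncomputable def harmonicConst (k : ℕ) : ℝ :=
  sInf {c : ℝ | 0 < c ∧ IsWeightingFunction fun x => harmonicFn k x / c}

theorem harmonicFn_bounds {k : ℕ} (hk : 3 ≤ k) {x : ℝ} (hx : x ∈ Set.Icc (0:ℝ) 1) :
   0 ≤ harmonicFn k x ∧ harmonicFn k x ≤ 3 * x ∧ harmonicFn k x ≤ 1 := by
  have hk' : (3:ℝ) ≤ k := by exact_mod_cast hk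
  unfold harmonicFn
  split_ifs with h
  · have h1 : (k:ℝ)/((k:ℝ)-2) ≤ 3 := by rw [div_le_iff₀] <;> linarith
    have h0 : 0 ≤ (k:ℝ)/((k:ℝ)-2) := div_nonneg (by linarith) (by linarith)
    refine ⟨mul_nonneg h0 hx.1, mul_le_mul_of_nonneg_right h1 hx.1, ?_⟩
    calc _ ≤ (k:ℝ)/((k:ℝ)-2) * (1/k) := mul_le_mul_of_nonneg_left h h0
      _ = 1/((k:ℝ)-2) := by have : (k:ℝ)-2 ≠ 0 := by linarith
                            field_simp
      _ ≤ 1 := by rw [div_le_iff₀] <;> linarith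
  · have hx0 : 0 < x := lt_trans (by positivity) (not_le.mp h)
    have h1 : 1 ≤ ⌊1/x⌋₊ := Nat.le_floor (by rw [Nat.cast_one, le_div_iff₀ hx0]; linarith [hx.2])
    have h1' : (1:ℝ) ≤ ⌊1/x⌋₊ := by exact_mod_cast h1
    have h2 := Nat.lt_floor_add_one (1/x)
    rw [div_lt_iff₀ hx0] at h2
    refine ⟨by positivity, ?_, ?_⟩
    · rw [div_le_iff₀ (by linarith)]; nlinarith
    · rw [div_le_iff₀ (by linarith)]; linarith

theorem harmonicConst_isLeast {k : ℕ} (hk : 3 ≤ k) :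
  IsLeast {c : ℝ | 0 < c ∧ IsWeightingFunction fun x => harmonicFn k x / c} (harmonicConst k) := by
  have key : ∀ c : ℝ, (0 < c ∧ IsWeightingFunction fun x => harmonicFn k x / c) ↔
     1 ≤ c ∧ ∀ (m : ℕ) (x : Fin m → ℝ), 0 < m → (∀ i, x i ∈ Set.Icc (0 : ℝ) 1) →
      ∑ i, x i ≤ 1 → ∑ i, harmonicFn k (x i) ≤ c := by
    intro c
    constructor
    · rintro ⟨h0, h1, h2⟩
      constructor
      · have := (h1 1 (by simp)).2
        have e : harmonicFn k 1 = 1 := by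
          simpa using harmonicFn_of_mem_Ioc (k := k) (q := 1) (x := 1) le_rfl (by omega) (by norm_num)
        simp only [e] at this
        rwa [div_le_iff₀ h0, one_mul] at this
      · intro m x hm hx hs
        have := h2 m x hm hx hs
        rw [← Finset.sum_div, div_le_iff₀ h0, one_mul] at this
        exact this
    · rintro ⟨h0, h1⟩
      refine ⟨by linarith, fun x hx => ⟨div_nonneg (harmonicFn_bounds hk hx).1 (by linarith), ?_⟩, ?_⟩
      · show _ / _ ≤ _
        rw [div_le_iff₀ (by linarith)]; linarith [(harmonicFn_bounds hk hx).2.2]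
      · intro m x hm hx hs
        rw [← Finset.sum_div, div_le_iff₀ (by linarith), one_mul]
        exact h1 m x hm hx hs
  have hne : {c : ℝ | 0 < c ∧ IsWeightingFunction fun x => harmonicFn k x / c}.Nonempty := by
    refine ⟨3, (key 3).2 ⟨by norm_num, fun m x hm hx hs => ?_⟩⟩
    calc _ ≤ ∑ i, 3 * x i := Finset.sum_le_sum fun i _ => (harmonicFn_bounds hk (hx i)).2.1
      _ ≤ 3 := by rw [← Finset.mul_sum]; linarith
  refine ⟨(key _).2 ⟨?_, ?_⟩, fun c hc => csInf_le ⟨0, fun c hc => hc.1.le⟩ hc⟩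
  · exact le_csInf hne fun c hc => ((key c).1 hc).1
  · intro m x hm hx hs
    exact le_csInf hne fun c hc => ((key c).1 hc).2 m x hm hx hs

/-! ### Bin packing of `d`-dimensional boxes -/

/-- The open box with lowest corner `p` and side lengths `s`. -/
def openBox {d : ℕ} (p s : Fin d → ℝ) : Set (Fin d → ℝ) :=
  Set.univ.pi fun j => Set.Ioo (p j) (p j + s j)

/-- A packing, without rotations, of the items with side lengths `len i` into `N` unit cubes. -/
structure BoxPacking {ι : Type*} {d : ℕ} (len : ι → Fin d → ℝ) (N : ℕ) where
  bin : ι → Fin N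
  pos : ι → Fin d → ℝ
  inside : ∀ i j, 0 ≤ pos i j ∧ pos i j + len i j ≤ 1
  disjoint : ∀ i i', i ≠ i' → bin i = bin i' →
    Disjoint (openBox (pos i) (len i)) (openBox (pos i') (len i'))

/-- The minimum number of unit cubes needed to pack the items. -/
noncomputable def optBP {ι : Type*} {d : ℕ} (len : ι → Fin d → ℝ) : ℕ :=
  sInf {N : ℕ | Nonempty (BoxPacking len N)}

theorem boxPacking_exists {ι : Type*} [Fintype ι] {d : ℕ} (len : ι → Fin d → ℝ) (h : ∀ i j, len i j ∈ Set.Ioc (0:ℝ) 1) :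
   {N : ℕ | Nonempty (BoxPacking len N)}.Nonempty :=
 ⟨Fintype.card ι, ⟨⟨Fintype.equivFin ι, fun _ _ => 0, fun i j => by simpa using (h i j).2,
   fun i i' hne he => absurd ((Fintype.equivFin ι).injective he) hne⟩⟩⟩

/-! ### Shelf-based fractional packings of rectangles -/

structure Rect where
  width : ℝ
  height : ℝ

/-- Rounding a box with `b + 1` dimensions (`b` base dimensions, the last one is the height) to a
rectangle. -/
noncomputable def roundBox (k : ℕ) {b : ℕ} (l : Fin (b + 1) → ℝ) : Rect where
  width := ∏ j : Fin b, harmonicFn k (l j.castSucc)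
  height := l (Fin.last b)

/-- `Slicing horiz r L`: the list `L` of rectangles arises from `r` by recursive slicing, with
vertical cuts, and also with horizontal cuts if `horiz` holds. -/
inductive Slicing (horiz : Prop) : Rect → List Rect → Prop
  | uncut (r : Rect) : Slicing horiz r [r]
  | vert {w₁ w₂ h : ℝ} {L₁ L₂ : List Rect} : 0 < w₁ → 0 < w₂ →
      Slicing horiz ⟨w₁, h⟩ L₁ → Slicing horiz ⟨w₂, h⟩ L₂ →
      Slicing horiz ⟨w₁ + w₂, h⟩ (L₁ ++ L₂)
  | horz {w h₁ h₂ : ℝ} {L₁ L₂ : List Rect} : horiz → 0 < h₁ → 0 < h₂ →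
      Slicing horiz ⟨w, h₁⟩ L₁ → Slicing horiz ⟨w, h₂⟩ L₂ →
      Slicing horiz ⟨w, h₁ + h₂⟩ (L₁ ++ L₂)

/-- The index type of all slices of all items. -/
abbrev SliceIdx {ι : Type*} (slices : ι → List Rect) : Type _ :=
  Σ i : ι, Fin (slices i).length

/-- The rectangle of a slice. -/
def sliceRect {ι : Type*} (slices : ι → List Rect) (s : SliceIdx slices) : Rect :=
  (slices s.1).get s.2

/-- The open rectangle with lower left corner `(x, y)` and the dimensions of `r`. -/
def openRect (x y : ℝ) (r : Rect) : Set (ℝ × ℝ) :=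
  Set.Ioo x (x + r.width) ×ˢ Set.Ioo y (y + r.height)

/-- A shelf-based `δ`-fractional packing of the rectangles `K i` into `N` unit squares. Items of
height `> δ` are `δ`-large, the others are `δ`-small. A shelf has width `1`, so that its left edge
is the left edge of its bin. -/
structure ShelfPacking {ι : Type*} (δ : ℝ) (K : ι → Rect) (N : ℕ) where
  slices : ι → List Rect
  slicing : ∀ i, Slicing ((K i).height ≤ δ) (K i) (slices i)
  numShelves : ℕ
  shelfHeight : Fin numShelves → ℝ
  shelfBin : Fin numShelves → Fin N
  shelfBot : Fin numShelves → ℝ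
  shelf_pos : ∀ t, 0 < shelfHeight t
  shelf_inside : ∀ t, 0 ≤ shelfBot t ∧ shelfBot t + shelfHeight t ≤ 1
  shelf_disjoint : ∀ t t', t ≠ t' → shelfBin t = shelfBin t' →
    Disjoint (openRect 0 (shelfBot t) ⟨1, shelfHeight t⟩)
      (openRect 0 (shelfBot t') ⟨1, shelfHeight t'⟩)
  bin : SliceIdx slices → Fin N
  left : SliceIdx slices → ℝ
  bot : SliceIdx slices → ℝ
  inside : ∀ s, 0 ≤ left s ∧ left s + (sliceRect slices s).width ≤ 1 ∧
    0 ≤ bot s ∧ bot s + (sliceRect slices s).height ≤ 1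
  disjoint : ∀ s s', s ≠ s' → bin s = bin s' →
    Disjoint (openRect (left s) (bot s) (sliceRect slices s))
      (openRect (left s') (bot s') (sliceRect slices s'))
  /-- Slices of large items lie in shelves, on the bottom edge of the shelf. -/
  large : ∀ s, δ < (K s.1).height →
    ∃ t, shelfBin t = bin s ∧ shelfBot t = bot s ∧ (sliceRect slices s).height ≤ shelfHeight t
  /-- Slices of small items lie outside the shelves. -/
  small : ∀ s, (K s.1).height ≤ δ → ∀ t, shelfBin t = bin s →
    Disjoint (openRect (left s) (bot s) (sliceRect slices s))
      (openRect 0 (shelfBot t) ⟨1, shelfHeight t⟩)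

/-- The shelves have at most `⌈1 / δ ^ 2⌉` distinct heights, each of them being the height of some
`δ`-large item. -/
def ShelfPacking.IsStructured {ι : Type*} {δ : ℝ} {K : ι → Rect} {N : ℕ}
    (P : ShelfPacking δ K N) : Prop :=
  (Set.range P.shelfHeight).ncard ≤ ⌈1 / δ ^ 2⌉₊ ∧
    ∀ t, ∃ i, δ < (K i).height ∧ P.shelfHeight t = (K i).height

/-- The minimum number of bins in a structured `δ`-fractional packing. -/
noncomputable def sopt {ι : Type*} (δ : ℝ) (K : ι → Rect) : ℕ :=
  sInf {N : ℕ | ∃ P : ShelfPacking δ K N, P.IsStructured}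

/-! ### Fractional colouring of intervals -/

/-! Put `b = d - 1` and `W = T_k ^ b * opt`, and keep only the vertical positions of an optimal box
packing. A product of weighting functions is a weighting function for boxes in a cube
(`IsWeightingFunction.sum_prod_le`), so every horizontal level meets rounded items of total width at
most `W` (`roundBox_cover`). Interval graphs being perfect, the items can then be spread
fractionally over columns of total width `W`, each a stack of height at most `1`
(`exists_interval_coloring`); in particular the total area is at most `W`.

The rest is linear grouping (`exists_structured_packing`). The large items, of total width `Ω`, are
laid out by decreasing height and cut into `⌈1/δ²⌉` groups of equal width `g`. The tallest item of a
group is no taller than any item of the preceding group, so shelves for group `j + 1` can replace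
group `j` in the columns, and only the first group needs `⌈g⌉` extra bins. Carathéodory
(`exists_small_columns`) leaves at most `⌈1/δ²⌉` kinds of columns, so rounding their multiplicities
up costs at most `⌈1/δ²⌉` bins. Since `δ Ω ≤ W` by area, `g ≤ δ² Ω ≤ δ W`. The columns are given
total weight `W + δ`; the surplus makes the free area strictly larger than that of the small items,
which are then cut into thin strips filling rows above the shelves
(`exists_shelfPacking_of_counts`). -/

/-- Weighted intervals `(a i, e i)` that cover every point with total weight at most `W` can be
distributed over columns of total weight `W`, each consisting of pairwise disjoint intervals. -/
theorem exists_interval_coloring {ι : Type*} [DecidableEq ι] (a e w : ι → ℝ) (W : ℝ) (hW : 0 ≤ W)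
    (S : Finset ι) (hae : ∀ i ∈ S, a i < e i) (hw : ∀ i ∈ S, 0 ≤ w i)
    (hcov : ∀ i ∈ S, ∑ j ∈ S with a j ≤ a i ∧ a i < e j, w j ≤ W) :
    ∃ (κ : Type) (_ : Fintype κ) (c : κ → Finset ι) (x : κ → ℝ),
      (∀ k, 0 ≤ x k) ∧ (∀ k, c k ⊆ S) ∧
      (∀ k, ∀ i ∈ c k, ∀ j ∈ c k, i ≠ j → e i ≤ a j ∨ e j ≤ a i) ∧
      ∑ k, x k = W ∧ ∀ i ∈ S, ∑ k, (if i ∈ c k then x k else 0) = w i := by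
  classical
  -- Greedy colouring by increasing left endpoint: an earlier interval obstructs the new one `i`
  -- only if it contains the point `a i`.
  induction S using Finset.induction_on_max_value a with
  | empty => exact ⟨Unit, inferInstance, fun _ => ∅, fun _ => W, by simp [hW]⟩
  | insert i S hi hmax ih =>
    have hcov' : ∀ j ∈ S, ∑ l ∈ S with a l ≤ a j ∧ a j < e l, w l ≤ W := by
      intro j hj
      refine le_trans (Finset.sum_le_sum_of_subset_of_nonneg ?_ ?_)
        (hcov j (Finset.mem_insert_of_mem hj))
      · exact Finset.filter_subset_filter _ (Finset.subset_insert _ _)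
      · intro l hl _
        exact hw l (Finset.mem_filter.1 hl).1
    obtain ⟨κ, _, c, x, hx0, hcS, hdis, hsum, hcw⟩ := ih
      (fun j hj => hae j (Finset.mem_insert_of_mem hj))
      (fun j hj => hw j (Finset.mem_insert_of_mem hj)) hcov'
    have hic : ∀ k, i ∉ c k := fun k h => hi (hcS k h)
    have hwi : 0 ≤ w i := hw i (Finset.mem_insert_self _ _)
    have hei : a i < e i := hae i (Finset.mem_insert_self _ _)
    -- the columns that leave room for the new interval
    let free : κ → Prop := fun k => ∀ j ∈ c k, e j ≤ a i
    set A : ℝ := ∑ k, (if free k then x k else 0) with hA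
    have hA0 : 0 ≤ A := Finset.sum_nonneg fun k _ => by split_ifs; exacts [hx0 k, le_rfl]
    have hwA : w i ≤ A := by
      have h1 := hcov i (Finset.mem_insert_self _ _)
      rw [Finset.filter_insert, if_pos ⟨le_rfl, hei⟩, Finset.sum_insert (by simp [hi])] at h1
      -- Each column that is not free contains an interval through `a i`, so the blocked weight is
      -- at most that of the old intervals over `a i`, hence at most `W - w i`.
      have h2 : W - A ≤ ∑ j ∈ S with a j ≤ a i ∧ a i < e j, w j := by
        calc W - A = ∑ k, (if free k then 0 else x k) := by
              rw [← hsum, hA, ← Finset.sum_sub_distrib]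
              refine Finset.sum_congr rfl fun k _ => ?_
              split_ifs <;> simp
          _ ≤ ∑ k, ∑ j ∈ S with a j ≤ a i ∧ a i < e j, (if j ∈ c k then x k else 0) := by
              refine Finset.sum_le_sum fun k _ => ?_
              have hnn : ∀ j ∈ S.filter (fun j => a j ≤ a i ∧ a i < e j),
                  0 ≤ (if j ∈ c k then x k else 0) := fun j _ => by
                split_ifs; exacts [hx0 k, le_rfl]
              split_ifs with hf
              · exact Finset.sum_nonneg hnn
              · simp only [free, not_forall, not_le] at hf
                obtain ⟨j, hj, hlt⟩ := hf
                have := Finset.single_le_sum hnn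
                  (Finset.mem_filter.2 ⟨hcS k hj, hmax j (hcS k hj), hlt⟩)
                rwa [if_pos hj] at this
          _ = _ := by
              rw [Finset.sum_comm]
              exact Finset.sum_congr rfl fun j hj => hcw j (Finset.mem_filter.1 hj).1
      linarith
    set α : ℝ := w i / A with hα
    have hα0 : 0 ≤ α := div_nonneg hwi hA0
    have hα1 : α ≤ 1 := div_le_one_of_le₀ hwA hA0
    have hαA : α * A = w i := by
      rcases eq_or_ne A 0 with h | h
      · rw [h, mul_zero]; linarith
      · exact div_mul_cancel₀ _ h
    -- Every free column is split in the ratio `1 - α : α`, and `i` is inserted in the second part.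
    refine ⟨κ ⊕ κ, inferInstance,
      Sum.elim c (fun k => if free k then insert i (c k) else ∅),
      Sum.elim (fun k => if free k then (1 - α) * x k else x k)
        (fun k => if free k then α * x k else 0), ?_, ?_, ?_, ?_, ?_⟩
    · rintro (k | k)
      · simp only [Sum.elim_inl]
        split_ifs
        exacts [mul_nonneg (by linarith) (hx0 k), hx0 k]
      · simp only [Sum.elim_inr]
        split_ifs
        exacts [mul_nonneg hα0 (hx0 k), le_rfl]
    · rintro (k | k)
      · exact (hcS k).trans (Finset.subset_insert _ _)
      · simp only [Sum.elim_inr]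
        split_ifs
        exacts [Finset.insert_subset_insert _ (hcS k), Finset.empty_subset _]
    · rintro (k | k)
      · exact hdis k
      · simp only [Sum.elim_inr]
        split_ifs with hf
        · intro j hj l hl hne
          rcases Finset.mem_insert.1 hj with hj' | hj' <;>
            rcases Finset.mem_insert.1 hl with hl' | hl'
          · exact absurd (hj'.trans hl'.symm) hne
          · exact Or.inr (hj' ▸ hf l hl')
          · exact Or.inl (hl' ▸ hf j hj')
          · exact hdis k j hj' l hl' hne
        · simp
    · rw [Fintype.sum_sum_type, ← Finset.sum_add_distrib, ← hsum]
      refine Finset.sum_congr rfl fun k _ => ?_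
      simp only [Sum.elim_inl, Sum.elim_inr]
      split_ifs <;> ring
    · intro j hj
      rw [Fintype.sum_sum_type]
      simp only [Sum.elim_inl, Sum.elim_inr]
      rcases Finset.mem_insert.1 hj with rfl | hj
      · rw [← hαA, hA, Finset.mul_sum, ← Finset.sum_add_distrib]
        refine Finset.sum_congr rfl fun k _ => ?_
        by_cases hf : free k <;> simp [hf, hic k]
      · have hne : j ≠ i := fun h => hi (h ▸ hj)
        rw [← hcw j hj, ← Finset.sum_add_distrib]
        refine Finset.sum_congr rfl fun k _ => ?_
        by_cases hf : free k <;> by_cases hjk : j ∈ c k <;> simp [hf, hjk, hne]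
        ring

/-- Reformulation of the covering condition of `exists_interval_coloring` with open intervals. -/
theorem cover_left_le_of_cover {ι : Type*} (a e w : ι → ℝ) (W : ℝ) (S : Finset ι)
    (hw : ∀ i ∈ S, 0 ≤ w i)
    (hcov : ∀ y : ℝ, ∑ j ∈ S with y ∈ Set.Ioo (a j) (e j), w j ≤ W) (y : ℝ) :
    ∑ j ∈ S with a j ≤ y ∧ y < e j, w j ≤ W := by
  -- A point slightly to the right of `y` lies inside every open interval whose half-open version
  -- contains `y`.
  have h : ∀ᶠ z in nhdsWithin y (Set.Ioi y), ∀ j ∈ S, y < e j → z < e j := by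
    rw [Filter.eventually_all_finset]
    intro j _
    by_cases hj : y < e j
    · filter_upwards [nhdsWithin_le_nhds (Iio_mem_nhds hj)] with z hz _ using hz
    · exact Filter.Eventually.of_forall fun z hz => absurd hz hj
  obtain ⟨z, hz, hyz⟩ := (h.and self_mem_nhdsWithin).exists
  refine le_trans (Finset.sum_le_sum_of_subset_of_nonneg ?_ ?_) (hcov z)
  · intro j hj
    obtain ⟨hj, h1, h2⟩ := Finset.mem_filter.1 hj
    exact Finset.mem_filter.2 ⟨hj, lt_of_le_of_lt h1 hyz, hz j hj h2⟩
  · intro j hj _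
    exact hw j (Finset.mem_filter.1 hj).1

/-- Pairwise disjoint intervals inside `[0, B]` have total length at most `B`. -/
theorem sum_length_le_of_disjoint {ι : Type*} (a e : ι → ℝ) (S : Finset ι)
    (hae : ∀ i ∈ S, a i < e i) (ha : ∀ i ∈ S, 0 ≤ a i)
    (hdis : ∀ i ∈ S, ∀ j ∈ S, i ≠ j → e i ≤ a j ∨ e j ≤ a i)
    (B : ℝ) (hB : 0 ≤ B) (he : ∀ i ∈ S, e i ≤ B) : ∑ i ∈ S, (e i - a i) ≤ B := by
  classical
  induction S using Finset.induction_on_max_value a generalizing B with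
  | empty => simpa using hB
  | insert i S hi hmax ih =>
    rw [Finset.sum_insert hi]
    simp only [Finset.forall_mem_insert] at hae ha he
    -- The other intervals start no later than `i`, so by disjointness they lie in `[0, a i]`.
    have := ih hae.2 ha.2
      (fun j hj l hl => hdis j (Finset.mem_insert_of_mem hj) l (Finset.mem_insert_of_mem hl))
      (a i) ha.1 (fun j hj => by
        rcases hdis i (Finset.mem_insert_self _ _) j (Finset.mem_insert_of_mem hj)
          (fun h => hi (h ▸ hj)) with h | h
        · linarith [hmax j hj, hae.1]
        · exact h)
    linarith [he.1]

/-- The weighted sum of a function over all intervals is its weighted sum over the columns. -/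
theorem sum_columns {ι κ : Type*} [DecidableEq ι] [Fintype κ] (S : Finset ι) (c : κ → Finset ι)
    (x : κ → ℝ) (w F : ι → ℝ) (hcS : ∀ k, c k ⊆ S)
    (hcw : ∀ i ∈ S, ∑ k, (if i ∈ c k then x k else 0) = w i) :
    ∑ k, x k * ∑ i ∈ c k, F i = ∑ i ∈ S, w i * F i := by
  calc ∑ k, x k * ∑ i ∈ c k, F i = ∑ k, ∑ i ∈ S, (if i ∈ c k then x k else 0) * F i := by
        refine Finset.sum_congr rfl fun k _ => ?_
        simp only [ite_mul, zero_mul]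
        rw [← Finset.sum_filter, Finset.filter_mem_eq_inter, Finset.inter_eq_right.2 (hcS k),
          Finset.mul_sum]
    _ = _ := by
        rw [Finset.sum_comm]
        refine Finset.sum_congr rfl fun i hi => ?_
        rw [← hcw i hi, Finset.sum_mul]

/-- If `F` sums to at most `1` over any family of disjoint intervals in `[0, 1]`, its weighted sum
is at most the covering number. -/
theorem weighted_sum_le_of_cover {ι : Type*} (a e w F : ι → ℝ) (W : ℝ) (hW : 0 ≤ W)
    (S : Finset ι) (hae : ∀ i ∈ S, a i < e i) (ha : ∀ i ∈ S, 0 ≤ a i) (he : ∀ i ∈ S, e i ≤ 1)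
    (hw : ∀ i ∈ S, 0 ≤ w i)
    (hcov : ∀ y : ℝ, ∑ j ∈ S with y ∈ Set.Ioo (a j) (e j), w j ≤ W)
    (hF : ∀ c ⊆ S, ∑ i ∈ c, (e i - a i) ≤ 1 → ∑ i ∈ c, F i ≤ 1) :
    ∑ i ∈ S, w i * F i ≤ W := by
  classical
  obtain ⟨κ, _, c, x, hx0, hcS, hdis, hsum, hcw⟩ := exists_interval_coloring a e w W hW S hae hw
    fun i _ => cover_left_le_of_cover a e w W S hw hcov _
  rw [← sum_columns S c x w F hcS hcw, ← hsum]
  refine Finset.sum_le_sum fun k _ => mul_le_of_le_one_right (hx0 k) (hF _ (hcS k) ?_)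
  exact sum_length_le_of_disjoint a e (c k) (fun i hi => hae i (hcS k hi))
    (fun i hi => ha i (hcS k hi)) (hdis k) 1 zero_le_one (fun i hi => he i (hcS k hi))

/-! ### Weighting functions and box packings -/

/-- A common point of the two shadows, completed by the shared last coordinate `y`, would lie in
both boxes. -/
theorem disjoint_openBox_castSucc {d : ℕ} {p s p' s' : Fin (d + 1) → ℝ}
    (h : Disjoint (openBox p s) (openBox p' s')) {y : ℝ}
    (hy : y ∈ Set.Ioo (p (Fin.last d)) (p (Fin.last d) + s (Fin.last d)))
    (hy' : y ∈ Set.Ioo (p' (Fin.last d)) (p' (Fin.last d) + s' (Fin.last d))) :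
    Disjoint (openBox (fun j : Fin d => p j.castSucc) fun j => s j.castSucc)
      (openBox (fun j : Fin d => p' j.castSucc) fun j => s' j.castSucc) := by
  rw [Set.disjoint_left] at h ⊢
  intro z hz hz'
  have key : ∀ {p s : Fin (d + 1) → ℝ},
      y ∈ Set.Ioo (p (Fin.last d)) (p (Fin.last d) + s (Fin.last d)) →
      z ∈ openBox (fun j : Fin d => p j.castSucc) (fun j => s j.castSucc) →
      (Fin.snoc z y : Fin (d + 1) → ℝ) ∈ openBox p s := by
    intro p s h1 h2 j _
    refine Fin.lastCases ?_ (fun j => ?_) j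
    · simpa using h1
    · simpa using h2 j trivial
  exact h (key hy hz) (key hy' hz')

theorem IsWeightingFunction.sum_le {g : ℝ → ℝ} (hg : IsWeightingFunction g) {ι : Type*}
    (S : Finset ι) (x : ι → ℝ) (hx : ∀ i ∈ S, x i ∈ Set.Icc (0 : ℝ) 1) (hs : ∑ i ∈ S, x i ≤ 1) :
    ∑ i ∈ S, g (x i) ≤ 1 := by
  rcases S.eq_empty_or_nonempty with rfl | hne
  · simp
  have := hg.2 S.card (fun i => x (S.equivFin.symm i)) hne.card_pos
    (fun i => hx _ (S.equivFin.symm i).2) (by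
      rw [Equiv.sum_comp S.equivFin.symm (fun i : S => x i), Finset.sum_coe_sort S x]; exact hs)
  rwa [Equiv.sum_comp S.equivFin.symm (fun i : S => g (x i)),
    Finset.sum_coe_sort S (fun i => g (x i))] at this

/-- A product of weighting functions is a weighting function for boxes packed in a cube. -/
theorem IsWeightingFunction.sum_prod_le {g : ℝ → ℝ} (hg : IsWeightingFunction g) {ι : Type*}
    {d : ℕ} (S : Finset ι) (pos len : ι → Fin d → ℝ)
    (hlen : ∀ i ∈ S, ∀ j, len i j ∈ Set.Ioc (0 : ℝ) 1)
    (hin : ∀ i ∈ S, ∀ j, 0 ≤ pos i j ∧ pos i j + len i j ≤ 1)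
    (hdis : ∀ i ∈ S, ∀ i' ∈ S, i ≠ i' →
      Disjoint (openBox (pos i) (len i)) (openBox (pos i') (len i'))) :
    ∑ i ∈ S, ∏ j, g (len i j) ≤ 1 := by
  induction d generalizing S with
  | zero =>
    -- In dimension `0` every open box is the whole one-point space, so disjointness allows only one
    -- item.
    have : S.card ≤ 1 := by
      rw [Finset.card_le_one]
      intro i hi i' hi'
      by_contra hne
      have := hdis i hi i' hi' hne
      rw [Set.disjoint_left] at this
      exact this (a := fun j => j.elim0) (fun j => j.elim0) (fun j => j.elim0)
    simpa using this
  | succ d ih =>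
    simp only [Fin.prod_univ_castSucc]
    have hmem : ∀ i ∈ S, ∀ j, g (len i j) ∈ Set.Icc (0 : ℝ) 1 := fun i hi j =>
      hg.1 _ ⟨(hlen i hi j).1.le, (hlen i hi j).2⟩
    -- The intervals are the projections to the last axis, weighted by the product over the other
    -- axes. The induction hypothesis on a hyperplane section bounds the cover by `1`, and `g`
    -- bounds each stack.
    refine weighted_sum_le_of_cover (fun i => pos i (Fin.last d))
      (fun i => pos i (Fin.last d) + len i (Fin.last d)) _ _ 1 zero_le_one S
      (fun i hi => by linarith [(hlen i hi (Fin.last d)).1]) (fun i hi => (hin i hi _).1)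
      (fun i hi => (hin i hi _).2) (fun i hi => Finset.prod_nonneg fun j _ => (hmem i hi _).1)
      (fun y => ?_) (fun c hc hs => ?_)
    · refine ih _ (fun i j => pos i j.castSucc) (fun i j => len i j.castSucc) ?_ ?_ ?_
      · exact fun i hi j => hlen i (Finset.mem_filter.1 hi).1 _
      · exact fun i hi j => hin i (Finset.mem_filter.1 hi).1 _
      · intro i hi i' hi' hne
        obtain ⟨hi, hy⟩ := Finset.mem_filter.1 hi
        obtain ⟨hi', hy'⟩ := Finset.mem_filter.1 hi'
        exact disjoint_openBox_castSucc (hdis i hi i' hi' hne) hy hy'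
    · refine hg.sum_le c _ (fun i hi => ⟨(hlen i (hc hi) _).1.le, (hlen i (hc hi) _).2⟩) ?_
      simpa using hs

theorem harmonicFn_pos {k : ℕ} (hk : 3 ≤ k) {x : ℝ} (hx : x ∈ Set.Ioc (0 : ℝ) 1) :
    0 < harmonicFn k x := by
  have hk' : (3 : ℝ) ≤ k := by exact_mod_cast hk
  unfold harmonicFn
  split_ifs with h
  · exact mul_pos (div_pos (by linarith) (by linarith)) hx.1
  · have h1 : 1 ≤ ⌊1 / x⌋₊ :=
      Nat.le_floor (by rw [Nat.cast_one, le_div_iff₀ hx.1]; linarith [hx.2])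
    have : (0 : ℝ) < ⌊1 / x⌋₊ := by exact_mod_cast h1
    positivity

/-- Every horizontal plane meets rounded items of total width at most `T_k ^ b` per bin. -/
theorem roundBox_cover {ι : Type*} [Fintype ι] {b k : ℕ} (hk : 3 ≤ k) {len : ι → Fin (b + 1) → ℝ}
    (hlen : ∀ i j, len i j ∈ Set.Ioc (0 : ℝ) 1) {m : ℕ} (P : BoxPacking len m) (y : ℝ) :
    ∑ i with y ∈ Set.Ioo (P.pos i (Fin.last b)) (P.pos i (Fin.last b) + len i (Fin.last b)),
      (roundBox k (len i)).width ≤ harmonicConst k ^ b * m := by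
  obtain ⟨hT, hg⟩ := (harmonicConst_isLeast hk).1
  set S := Finset.univ.filter fun i =>
    y ∈ Set.Ioo (P.pos i (Fin.last b)) (P.pos i (Fin.last b) + len i (Fin.last b)) with hS
  rw [← Finset.sum_fiberwise S P.bin]
  have hbin : ∀ t : Fin m, ∑ i ∈ S with P.bin i = t, (roundBox k (len i)).width
      ≤ harmonicConst k ^ b := by
    intro t
    have := hg.sum_prod_le (S.filter fun i => P.bin i = t) (fun i j => P.pos i j.castSucc)
      (fun i (j : Fin b) => len i j.castSucc) (fun i _ j => hlen i _) (fun i _ j => P.inside i _) ?_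
    · simp only [Finset.prod_div_distrib, Finset.prod_const, Finset.card_univ, Fintype.card_fin,
        ← Finset.sum_div] at this
      rwa [div_le_one (by positivity)] at this
    · intro i hi i' hi' hne
      simp only [hS, Finset.mem_filter, Finset.mem_univ, true_and] at hi hi'
      exact disjoint_openBox_castSucc (P.disjoint i i' hne (hi.2.trans hi'.2.symm)) hi.1 hi'.1
  calc _ ≤ ∑ _t : Fin m, harmonicConst k ^ b := Finset.sum_le_sum fun t _ => hbin t
    _ = _ := by simp [mul_comm]

/-! ### Laying out and cutting segments on a line -/

/-- Segments of lengths `w i` can be laid out consecutively, by decreasing values of `h`. -/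
theorem exists_layout {ι : Type*} (w h : ι → ℝ) (S : Finset ι) (hw : ∀ i ∈ S, 0 ≤ w i) :
    ∃ s : ι → ℝ, (∀ i ∈ S, 0 ≤ s i ∧ s i + w i ≤ ∑ j ∈ S, w j) ∧
      (∀ i ∈ S, ∀ j ∈ S, i ≠ j → s i + w i ≤ s j ∨ s j + w j ≤ s i) ∧
      (∀ t, 0 ≤ t → t < ∑ j ∈ S, w j → ∃ i ∈ S, s i ≤ t ∧ t < s i + w i) ∧
      (∀ i ∈ S, ∀ j ∈ S, s i < s j → h j ≤ h i) ∧
      ∀ F : ℝ → ℝ, ∑ i ∈ S, (F (s i + w i) - F (s i)) = F (∑ j ∈ S, w j) - F 0 := by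
  classical
  -- The segment with the smallest `h` is appended at the right end. The telescoping identity for
  -- arbitrary `F` later measures how much of the layout lies in each group.
  induction S using Finset.induction_on_min_value h with
  | empty => exact ⟨0, by simp, by simp, fun t h1 h2 => by simp at h2; linarith, by simp, by simp⟩
  | insert a S ha hmin ih =>
    obtain ⟨s, h1, h2, h3, h4, h5⟩ := ih fun i hi => hw i (Finset.mem_insert_of_mem hi)
    have hwa : 0 ≤ w a := hw a (Finset.mem_insert_self _ _)
    have hsum : 0 ≤ ∑ j ∈ S, w j :=
      Finset.sum_nonneg fun i hi => hw i (Finset.mem_insert_of_mem hi)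
    have hne : ∀ i ∈ S, i ≠ a := fun i hi h => ha (h ▸ hi)
    set s' := Function.update s a (∑ j ∈ S, w j) with hs'
    have hsa : s' a = ∑ j ∈ S, w j := Function.update_self _ _ _
    have hsi : ∀ i ∈ S, s' i = s i := fun i hi => Function.update_of_ne (hne i hi) _ _
    refine ⟨s', ?_, ?_, ?_, ?_, ?_⟩
    · rw [Finset.sum_insert ha, Finset.forall_mem_insert, hsa]
      refine ⟨⟨hsum, by linarith⟩, fun i hi => ?_⟩
      rw [hsi i hi]
      exact ⟨(h1 i hi).1, by linarith [(h1 i hi).2]⟩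
    · intro i hi j hj hij
      rcases Finset.mem_insert.1 hi with hi' | hi' <;> rcases Finset.mem_insert.1 hj with hj' | hj'
      · exact absurd (hi'.trans hj'.symm) hij
      · subst hi'
        rw [hsa, hsi j hj']
        exact Or.inr (h1 j hj').2
      · subst hj'
        rw [hsa, hsi i hi']
        exact Or.inl (h1 i hi').2
      · rw [hsi i hi', hsi j hj']
        exact h2 i hi' j hj' hij
    · intro t ht0 ht
      rw [Finset.sum_insert ha] at ht
      by_cases hlt : t < ∑ j ∈ S, w j
      · obtain ⟨i, hi, hit⟩ := h3 t ht0 hlt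
        exact ⟨i, Finset.mem_insert_of_mem hi, by rwa [hsi i hi]⟩
      · exact ⟨a, Finset.mem_insert_self _ _, by rw [hsa]; exact ⟨not_lt.1 hlt, by linarith⟩⟩
    · intro i hi j hj hij
      rcases Finset.mem_insert.1 hi with hi' | hi' <;> rcases Finset.mem_insert.1 hj with hj' | hj'
      · rw [hi', hj']
      · subst hi'
        rw [hsa, hsi j hj'] at hij
        linarith [(h1 j hj').2, hw j hj]
      · subst hj'
        exact hmin i hi'
      · rw [hsi i hi', hsi j hj'] at hij
        exact h4 i hi' j hj' hij
    · intro F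
      have h6 : ∑ i ∈ S, (F (s' i + w i) - F (s' i)) = ∑ i ∈ S, (F (s i + w i) - F (s i)) :=
        Finset.sum_congr rfl fun i hi => by rw [hsi i hi]
      rw [Finset.sum_insert ha, Finset.sum_insert ha, hsa, h6, h5 F, add_comm (w a)]
      ring

/-- A slice placed in a slot, at horizontal offset `left`. -/
structure Piece (τ : Type*) where
  slot : τ
  left : ℝ
  width : ℝ
  height : ℝ

/-- The rectangle of a placed slice. -/
def Piece.rect {τ : Type*} (p : Piece τ) : Rect := ⟨p.width, p.height⟩

/-- Change of slots. -/
def Piece.map {τ τ' : Type*} (f : τ → τ') (p : Piece τ) : Piece τ' :=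
  ⟨f p.slot, p.left, p.width, p.height⟩

/-- The pieces `L` have height `h` and lie, from left to right, in the cells `[c γ, (c + 1) γ]`
inside the segment `[s, e]` of the line. -/
def LinePieces {C : ℕ} (γ h s e : ℝ) (L : List (Piece (Fin C))) : Prop :=
  (∀ p ∈ L, 0 ≤ p.left ∧ 0 < p.width ∧ p.left + p.width ≤ γ ∧ p.height = h ∧
    s ≤ p.slot * γ + p.left ∧ p.slot * γ + p.left + p.width ≤ e) ∧
  L.Pairwise fun p p' => (p.slot : ℝ) * γ + p.left + p.width ≤ p'.slot * γ + p'.left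

theorem LinePieces.append {C : ℕ} {γ h s m e : ℝ} {L L' : List (Piece (Fin C))} (hsm : s ≤ m)
    (hme : m ≤ e) (hL : LinePieces γ h s m L) (hL' : LinePieces γ h m e L') :
    LinePieces γ h s e (L ++ L') := by
  refine ⟨fun p hp => ?_, List.pairwise_append.2 ⟨hL.2, hL'.2, fun p hp p' hp' => ?_⟩⟩
  · rcases List.mem_append.1 hp with hp | hp
    · obtain ⟨h1, h2, h3, h4, h5, h6⟩ := hL.1 p hp
      exact ⟨h1, h2, h3, h4, h5, h6.trans hme⟩
    · obtain ⟨h1, h2, h3, h4, h5, h6⟩ := hL'.1 p hp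
      exact ⟨h1, h2, h3, h4, hsm.trans h5, h6⟩
  · exact (hL.1 p hp).2.2.2.2.2.trans (hL'.1 p' hp').2.2.2.2.1

/-- A rectangle laid out on the segment `[s, s + w]` is cut vertically at the cell boundaries. -/
theorem exists_vertical_cut (horiz : Prop) {γ h : ℝ} (hγ : 0 < γ) (C : ℕ) {s w : ℝ} (hs : 0 ≤ s)
    (hw : 0 < w) (hC : s + w ≤ C * γ) :
    ∃ L : List (Piece (Fin C)), Slicing horiz ⟨w, h⟩ (L.map Piece.rect) ∧
      LinePieces γ h s (s + w) L := by
  -- Here `c` is the cell containing `s`, and `d` bounds the number of cells from `c` on.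
  have key : ∀ (d c : ℕ) (s w : ℝ), C ≤ c + d → 0 < w → s + w ≤ C * γ → c * γ ≤ s →
      s < (c + 1) * γ → ∃ L : List (Piece (Fin C)), Slicing horiz ⟨w, h⟩ (L.map Piece.rect) ∧
        LinePieces γ h s (s + w) L := by
    intro d
    induction d with
    | zero =>
      intro c s w hCc hw hC hcs _
      have : (C : ℝ) ≤ c := by exact_mod_cast hCc
      nlinarith
    | succ d ih =>
      intro c s w hCc hw hC hcs hsc
      have hcC : c < C := by
        have : (c : ℝ) < C := by
          by_contra h
          nlinarith [not_lt.1 h]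
        exact_mod_cast this
      by_cases hle : s + w ≤ (c + 1) * γ
      · refine ⟨[⟨⟨c, hcC⟩, s - c * γ, w, h⟩], Slicing.uncut _, ?_, by simp⟩
        simp only [List.mem_singleton, forall_eq]
        exact ⟨by linarith, hw, by linarith, trivial, by linarith, by linarith⟩
      · rw [not_le] at hle
        obtain ⟨L, hL, hL'⟩ := ih (c + 1) ((c + 1) * γ) (s + w - (c + 1) * γ) (by omega)
          (by linarith) (by linarith) (by push_cast; exact le_rfl) (by push_cast; linarith)
        refine ⟨⟨⟨c, hcC⟩, s - c * γ, (c + 1) * γ - s, h⟩ :: L, ?_, ?_⟩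
        · have := Slicing.vert (horiz := horiz) (sub_pos.2 hsc)
            (by linarith : 0 < s + w - (c + 1) * γ) (Slicing.uncut _) hL
          rwa [show (c + 1) * γ - s + (s + w - (c + 1) * γ) = w by ring] at this
        · rw [← List.singleton_append]
          refine LinePieces.append hsc.le hle.le ⟨?_, by simp⟩ ?_
          · simp only [List.mem_singleton, forall_eq]
            exact ⟨by linarith, by linarith, by linarith, trivial, by linarith, by linarith⟩
          · rwa [show (c + 1) * γ + (s + w - (c + 1) * γ) = s + w by ring] at hL'
  refine key C ⌊s / γ⌋₊ s w (by omega) hw hC ?_ ?_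
  · rw [← le_div_iff₀ hγ]
    exact Nat.floor_le (by positivity)
  · rw [← div_lt_iff₀ hγ]
    exact Nat.lt_floor_add_one _

/-- A rectangle cut horizontally into `n` strips, which are laid out on the segment
`[s, s + n w]` and cut vertically at the cell boundaries. -/
theorem exists_strip_cut {horiz : Prop} {γ h : ℝ} (hγ : 0 < γ) (hh : 0 < h) (C n : ℕ)
    (hhor : 1 < n → horiz) (hn : 1 ≤ n) {s w : ℝ} (hs : 0 ≤ s) (hw : 0 < w)
    (hC : s + n * w ≤ C * γ) :
    ∃ L : List (Piece (Fin C)), Slicing horiz ⟨w, n * h⟩ (L.map Piece.rect) ∧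
      LinePieces γ h s (s + n * w) L := by
  induction n, hn using Nat.le_induction with
  | base => simpa using exists_vertical_cut horiz (h := h) hγ C hs hw (by simpa using hC)
  | succ n hn ih =>
    have hn' : (0 : ℝ) < n := by exact_mod_cast hn
    push_cast at hC
    obtain ⟨L₁, h1, h1'⟩ := ih (fun _ => hhor (by omega)) (by linarith)
    obtain ⟨L₂, h2, h2'⟩ := exists_vertical_cut horiz (h := h) hγ C (s := s + n * w)
      (by positivity) hw (by linarith)
    refine ⟨L₁ ++ L₂, ?_, ?_⟩
    · have := Slicing.horz (hhor (by omega)) (by positivity) hh h1 h2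
      rw [List.map_append]
      rwa [show (n : ℝ) * h + h = (n + 1 : ℕ) * h by push_cast; ring] at this
    · rw [show s + ((n + 1 : ℕ) : ℝ) * w = s + n * w + w by push_cast; ring]
      exact LinePieces.append (by nlinarith) (by linarith) h1' h2'

/-! ### Shelf packings from pieces placed in slots -/

theorem disjoint_openRect_of_horizontal {x y x' y' : ℝ} {r r' : Rect}
    (h : x + r.width ≤ x' ∨ x' + r'.width ≤ x) : Disjoint (openRect x y r) (openRect x' y' r') := by
  rw [openRect, openRect, Set.disjoint_prod]
  refine Or.inl (Set.disjoint_left.2 fun z hz hz' => ?_)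
  rcases h with h | h
  · linarith [hz.2, hz'.1]
  · linarith [hz'.2, hz.1]

theorem disjoint_openRect_of_vertical {x y x' y' : ℝ} {r r' : Rect}
    (h : y + r.height ≤ y' ∨ y' + r'.height ≤ y) :
    Disjoint (openRect x y r) (openRect x' y' r') := by
  rw [openRect, openRect, Set.disjoint_prod]
  refine Or.inr (Set.disjoint_left.2 fun z hz hz' => ?_)
  rcases h with h | h
  · linarith [hz.2, hz'.1]
  · linarith [hz'.2, hz.1]

/-- Slots of width `1` stacked in bins, those of type `σ` being shelves, and pieces placed side by
side on the bottom edges of slots, form a shelf packing. -/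
theorem exists_shelfPacking_of_pieces {ι σ τ : Type*} [Fintype σ] {δ : ℝ} {K : ι → Rect} {N : ℕ}
    (bin : σ ⊕ τ → Fin N) (bot ht : σ ⊕ τ → ℝ) (hpos : ∀ a, 0 < ht (Sum.inl a))
    (hin : ∀ a, 0 ≤ bot a ∧ bot a + ht a ≤ 1)
    (hsep : ∀ a a', a ≠ a' → bin a = bin a' →
      bot a + ht a ≤ bot a' ∨ bot a' + ht a' ≤ bot a)
    (pieces : ι → List (Piece (σ ⊕ τ)))
    (hsl : ∀ i, Slicing ((K i).height ≤ δ) (K i) ((pieces i).map Piece.rect))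
    (hp : ∀ i, ∀ p ∈ pieces i, 0 ≤ p.left ∧ p.left + p.width ≤ 1 ∧ p.height ≤ ht p.slot)
    (hpair : ∀ i, (pieces i).Pairwise fun p p' => p.slot = p'.slot → p.left + p.width ≤ p'.left)
    (hne : ∀ i i', i ≠ i' → ∀ p ∈ pieces i, ∀ p' ∈ pieces i', p.slot = p'.slot →
      p.left + p.width ≤ p'.left ∨ p'.left + p'.width ≤ p.left)
    (hlarge : ∀ i, δ < (K i).height → ∀ p ∈ pieces i, ∃ a, p.slot = Sum.inl a)
    (hsmall : ∀ i, (K i).height ≤ δ → ∀ p ∈ pieces i, ∃ a, p.slot = Sum.inr a) :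
    ∃ P : ShelfPacking δ K N, ∀ t, ∃ a, P.shelfHeight t = ht (Sum.inl a) := by
  classical
  let e := (Fintype.equivFin σ).symm
  let slices : ι → List Rect := fun i => (pieces i).map Piece.rect
  let pc : SliceIdx slices → Piece (σ ⊕ τ) := fun s =>
    (pieces s.1).get (s.2.cast (List.length_map _))
  have hpc : ∀ s, pc s ∈ pieces s.1 := fun s => List.get_mem _ _
  have hrect : ∀ s, sliceRect slices s = (pc s).rect := fun s => by
    simp [sliceRect, slices, pc]
  have hrw : ∀ s, (sliceRect slices s).width = (pc s).width := fun s => by rw [hrect]; rfl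
  have hrh : ∀ s, (sliceRect slices s).height = (pc s).height := fun s => by rw [hrect]; rfl
  have hsame : ∀ s s', s ≠ s' → (pc s).slot = (pc s').slot →
      (pc s).left + (pc s).width ≤ (pc s').left ∨ (pc s').left + (pc s').width ≤ (pc s).left := by
    rintro ⟨i, a⟩ ⟨i', a'⟩ hss hslot
    by_cases hii : i = i'
    · subst hii
      have haa : a ≠ a' := fun h => hss (by rw [h])
      have hP := List.pairwise_iff_get.1 (hpair i)
      rcases lt_or_gt_of_ne haa with h | h
      · exact Or.inl (hP (a.cast (List.length_map _)) (a'.cast (List.length_map _)) h hslot)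
      · exact Or.inr (hP (a'.cast (List.length_map _)) (a.cast (List.length_map _)) h hslot.symm)
    · exact hne i i' hii _ (hpc ⟨i, a⟩) _ (hpc ⟨i', a'⟩) hslot
  refine ⟨{
    slices := slices
    slicing := hsl
    numShelves := Fintype.card σ
    shelfHeight := fun t => ht (Sum.inl (e t))
    shelfBin := fun t => bin (Sum.inl (e t))
    shelfBot := fun t => bot (Sum.inl (e t))
    shelf_pos := fun t => hpos _
    shelf_inside := fun t => hin _
    shelf_disjoint := fun t t' htt hb => disjoint_openRect_of_vertical
      (hsep _ _ (fun h => htt (e.injective (Sum.inl_injective h))) hb)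
    bin := fun s => bin (pc s).slot
    left := fun s => (pc s).left
    bot := fun s => bot (pc s).slot
    inside := fun s => ?_
    disjoint := fun s s' hss hb => ?_
    large := fun s hs => ?_
    small := fun s hs t htb => ?_ }, fun t => ⟨_, rfl⟩⟩
  · obtain ⟨h1, h2, h3⟩ := hp s.1 _ (hpc s)
    rw [hrw, hrh]
    exact ⟨h1, h2, (hin _).1, by linarith [(hin (pc s).slot).2]⟩
  -- Pieces in one slot are side by side; pieces in different slots of a bin are separated
  -- vertically.
  · by_cases hslot : (pc s).slot = (pc s').slot
    · exact disjoint_openRect_of_horizontal (by rw [hrw, hrw]; exact hsame s s' hss hslot)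
    · refine disjoint_openRect_of_vertical ?_
      rw [hrh, hrh]
      rcases hsep _ _ hslot hb with h | h
      · exact Or.inl (by linarith [(hp s.1 _ (hpc s)).2.2])
      · exact Or.inr (by linarith [(hp s'.1 _ (hpc s')).2.2])
  · obtain ⟨a, ha⟩ := hlarge s.1 hs _ (hpc s)
    refine ⟨e.symm a, ?_⟩
    simp only [Equiv.apply_symm_apply, ← ha, hrh, true_and]
    exact (hp s.1 _ (hpc s)).2.2
  · obtain ⟨a, ha⟩ := hsmall s.1 hs _ (hpc s)
    refine disjoint_openRect_of_vertical ?_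
    rw [hrh]
    have h3 := (hp s.1 _ (hpc s)).2.2
    rcases hsep (pc s).slot (Sum.inl (e t)) (by rw [ha]; exact Sum.inr_ne_inl) htb.symm with h | h
    · exact Or.inl (by linarith)
    · exact Or.inr h

/-- Given enough bins with shelves, `cnt t j` of them of height `H j` in the bin `t`, given the
large items laid out on a line cut at the multiples of `γ` so that each piece fits the shelf that it
is assigned to, and enough area for the small items, there is a shelf packing. -/
theorem exists_shelfPacking_of_counts {ι β : Type*} [Fintype ι] [Fintype β] {δ : ℝ}
    (K : ι → Rect) (hKw : ∀ i, 0 < (K i).width) (hKh : ∀ i, 0 < (K i).height)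
    (q M : ℕ) (H : Fin q → ℝ) (hH : ∀ j, 0 < H j) (cnt : β → Fin q → ℕ)
    (hbin : ∀ t, ∑ j, (cnt t j : ℝ) * H j ≤ 1) (hcnt : ∀ j, M ≤ ∑ t, cnt t j)
    (γ : ℝ) (hγ0 : 0 < γ) (hγ1 : γ ≤ 1) (s : ι → ℝ)
    (hs : ∀ i, δ < (K i).height → 0 ≤ s i ∧ s i + (K i).width ≤ (q * M : ℕ) * γ)
    (hsep : ∀ i i', δ < (K i).height → δ < (K i').height → i ≠ i' →
      s i + (K i).width ≤ s i' ∨ s i' + (K i').width ≤ s i)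
    (hfit : ∀ i, δ < (K i).height → ∀ j : Fin q, (j * M : ℝ) * γ < s i + (K i).width →
      (K i).height ≤ H j)
    (harea : ∑ i with (K i).height ≤ δ, (K i).width * (K i).height <
      ∑ t, (1 - ∑ j, (cnt t j : ℝ) * H j)) :
    ∃ P : ShelfPacking δ K (Fintype.card β), ∀ t, ∃ j, P.shelfHeight t = H j := by
  classical
  -- the shelves, stacked in each bin from the bottom
  let σ := Σ t : β, Σ j : Fin q, Fin (cnt t j)
  set f : β → ℝ := fun t => ∑ j, (cnt t j : ℝ) * H j with hf
  have hstack : ∀ t, ∃ y : (Σ j : Fin q, Fin (cnt t j)) → ℝ, (∀ a, 0 ≤ y a ∧ y a + H a.1 ≤ f t) ∧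
      ∀ a a', a ≠ a' → y a + H a.1 ≤ y a' ∨ y a' + H a'.1 ≤ y a := by
    intro t
    obtain ⟨y, h1, h2, -⟩ := exists_layout (fun a : Σ j : Fin q, Fin (cnt t j) => H a.1) 0
      Finset.univ fun a _ => (hH _).le
    have hsum : ∑ a : Σ j : Fin q, Fin (cnt t j), H a.1 = f t := by
      simp [Fintype.sum_sigma, hf]
    rw [hsum] at h1
    exact ⟨y, fun a => h1 a (Finset.mem_univ _),
      fun a a' h => h2 a (Finset.mem_univ _) a' (Finset.mem_univ _) h⟩
  choose y hy hysep using hstack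
  -- the rows, of height `η`, above the shelves
  set Sm : Finset ι := Finset.univ.filter fun i => (K i).height ≤ δ with hSm
  set Δ : ℝ := ∑ t, (1 - f t) - ∑ i ∈ Sm, (K i).width * (K i).height with hΔ
  have hΔ0 : 0 < Δ := sub_pos.2 harea
  -- `Q` bounds the waste, counted in rows: rounding up the numbers of strips costs at most the
  -- total width, rounding down the numbers of rows at most one row per bin. The extra `1` keeps `Q`
  -- positive.
  set Q : ℝ := ∑ i ∈ Sm, (K i).width + Fintype.card β + 1 with hQ
  have hQ0 : 0 < Q := by
    have : 0 ≤ ∑ i ∈ Sm, (K i).width := Finset.sum_nonneg fun i _ => (hKw i).le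
    positivity
  set η : ℝ := Δ / Q with hη
  have hη0 : 0 < η := div_pos hΔ0 hQ0
  let τ := Σ t : β, Fin ⌊(1 - f t) / η⌋₊
  let n : ι → ℕ := fun i => ⌈(K i).height / η⌉₊
  have hn1 : ∀ i, 1 ≤ n i := fun i => Nat.one_le_ceil_iff.2 (div_pos (hKh i) hη0)
  have hn0 : ∀ i, (0 : ℝ) < n i := fun i => by exact_mod_cast hn1 i
  have hnη : ∀ i, (K i).height / n i ≤ η := fun i => by
    rw [div_le_iff₀ (hn0 i), mul_comm, ← div_le_iff₀ hη0]
    exact Nat.le_ceil _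
  set R : ℕ := Fintype.card τ with hR
  have hrows : ∑ i ∈ Sm, (n i : ℝ) * (K i).width ≤ R * 1 := by
    have h1 : ∑ i ∈ Sm, (n i : ℝ) * (K i).width ≤
        (∑ i ∈ Sm, (K i).width * (K i).height) / η + ∑ i ∈ Sm, (K i).width := by
      rw [Finset.sum_div, ← Finset.sum_add_distrib]
      refine Finset.sum_le_sum fun i _ => ?_
      have := (Nat.ceil_lt_add_one (div_pos (hKh i) hη0).le).le
      calc (n i : ℝ) * (K i).width ≤ ((K i).height / η + 1) * (K i).width :=
            mul_le_mul_of_nonneg_right this (hKw i).le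
        _ = _ := by ring
    have h2 : (∑ t, (1 - f t)) / η - Fintype.card β ≤ R := by
      have : (R : ℝ) = ∑ t, (⌊(1 - f t) / η⌋₊ : ℝ) := by
        simp [hR, τ, Fintype.card_sigma]
      rw [this, Finset.sum_div]
      calc ∑ t, (1 - f t) / η - Fintype.card β = ∑ t, ((1 - f t) / η - 1) := by
            simp [Finset.sum_sub_distrib]
        _ ≤ _ := Finset.sum_le_sum fun t _ => (Nat.sub_one_lt_floor _).le
    have h3 : Δ / η = Q := by rw [hη]; field_simp
    rw [hΔ, sub_div] at h3
    linarith
  obtain ⟨z, hz, hzsep, -⟩ := exists_layout (fun i => (n i : ℝ) * (K i).width) 0 Sm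
    fun i _ => mul_nonneg (hn0 i).le (hKw i).le
  -- the assignment of cells to slots
  have hemb : ∀ j, Nonempty (Fin M ↪ Σ t, Fin (cnt t j)) := fun j =>
    Function.Embedding.nonempty_of_card_le (by simpa [Fintype.card_sigma] using hcnt j)
  have emb : ∀ j, Fin M ↪ Σ t, Fin (cnt t j) := fun j => (hemb j).some
  -- Cell `c` belongs to group `c / M`, whose `M` cells go to distinct shelves of height `H (c /
  -- M)`.
  let cellL : Fin (q * M) → σ ⊕ τ := fun c =>
    Sum.inl ⟨(emb c.divNat c.modNat).1, c.divNat, (emb c.divNat c.modNat).2⟩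
  have hcellL : Function.Injective cellL := by
    intro c c' h
    have h := Sum.inl_injective h
    rw [← finProdFinEquiv.symm.injective.eq_iff]
    change (c.divNat, c.modNat) = (c'.divNat, c'.modNat)
    generalize c.divNat = j at h ⊢
    generalize c.modNat = m at h ⊢
    generalize c'.divNat = j' at h ⊢
    generalize c'.modNat = m' at h ⊢
    obtain ⟨h1, h2⟩ := Sigma.mk.inj_iff.1 h
    have hj : j = j' := by
      have := congrArg (fun a : σ => a.2.1) h
      exact this
    subst hj
    have hm : emb j m = emb j m' := by
      refine Sigma.ext h1 ?_
      generalize emb j m = x at h1 h2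
      generalize emb j m' = x' at h1 h2
      obtain ⟨t, x⟩ := x
      obtain ⟨t', x'⟩ := x'
      dsimp only at h1
      subst h1
      simpa using h2
    rw [(emb j).injective hm]
  let cellS : Fin R → σ ⊕ τ := fun c => Sum.inr ((Fintype.equivFin τ).symm c)
  have hcellS : Function.Injective cellS := fun c c' h =>
    (Fintype.equivFin τ).symm.injective (Sum.inr_injective h)
  -- the slots
  let bin : σ ⊕ τ → Fin (Fintype.card β) := fun a =>
    Fintype.equivFin β (Sum.elim (fun a => a.1) (fun a => a.1) a)
  let bot : σ ⊕ τ → ℝ := Sum.elim (fun a => y a.1 a.2) (fun a => f a.1 + a.2 * η)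
  let ht : σ ⊕ τ → ℝ := Sum.elim (fun a => H a.2.1) (fun _ => η)
  have hf0 : ∀ t, 0 ≤ f t := fun t =>
    Finset.sum_nonneg fun j _ => mul_nonneg (Nat.cast_nonneg _) (hH j).le
  have hrow : ∀ a : τ, f a.1 + a.2 * η + η ≤ 1 := by
    rintro ⟨t, a⟩
    have h1 : ((a : ℕ) + 1 : ℝ) ≤ ⌊(1 - f t) / η⌋₊ := by exact_mod_cast a.2
    have h2 := h1.trans (Nat.floor_le (div_nonneg (sub_nonneg.2 (hbin t)) hη0.le))
    rw [le_div_iff₀ hη0] at h2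
    dsimp only
    linarith
  have hpieces : ∀ i, ∃ L : List (Piece (σ ⊕ τ)),
      Slicing ((K i).height ≤ δ) (K i) (L.map Piece.rect) ∧
      (∀ p ∈ L, 0 ≤ p.left ∧ p.left + p.width ≤ 1 ∧ p.height ≤ ht p.slot) ∧
      (L.Pairwise fun p p' => p.slot = p'.slot → p.left + p.width ≤ p'.left) ∧
      (δ < (K i).height → ∀ p ∈ L, ∃ c : Fin (q * M), p.slot = cellL c ∧ s i ≤ c * γ + p.left ∧
        c * γ + p.left + p.width ≤ s i + (K i).width) ∧
      ((K i).height ≤ δ → ∀ p ∈ L, ∃ c : Fin R, p.slot = cellS c ∧ z i ≤ c * 1 + p.left ∧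
        c * 1 + p.left + p.width ≤ z i + n i * (K i).width) := by
    intro i
    by_cases hi : (K i).height ≤ δ
    · have hiS : i ∈ Sm := by simp [hSm, hi]
      obtain ⟨L, h1, h2, h3⟩ := exists_strip_cut (horiz := (K i).height ≤ δ) zero_lt_one
        (div_pos (hKh i) (hn0 i)) R (n i) (fun _ => hi) (hn1 i) (hz i hiS).1 (hKw i)
        ((hz i hiS).2.trans hrows)
      rw [mul_div_cancel₀ _ (hn0 i).ne'] at h1
      refine ⟨L.map (Piece.map cellS), ?_, ?_, ?_, fun h => absurd hi (not_le.2 h), fun _ => ?_⟩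
      · rw [List.map_map]
        exact h1
      · intro p hp
        obtain ⟨p, hpL, rfl⟩ := List.mem_map.1 hp
        obtain ⟨g1, g2, g3, g4, g5, g6⟩ := h2 p hpL
        exact ⟨g1, g3, g4.le.trans (hnη i)⟩
      · rw [List.pairwise_map]
        refine h3.imp fun {p p'} h hpp => ?_
        have : p.slot = p'.slot := hcellS hpp
        rw [this] at h
        simp only [Piece.map]
        linarith
      · intro p hp
        obtain ⟨p, hpL, rfl⟩ := List.mem_map.1 hp
        obtain ⟨g1, g2, g3, g4, g5, g6⟩ := h2 p hpL
        exact ⟨p.slot, rfl, g5, g6⟩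
    · have hi' := not_le.1 hi
      obtain ⟨L, h1, h2, h3⟩ := exists_vertical_cut ((K i).height ≤ δ) (h := (K i).height) hγ0
        (q * M) (hs i hi').1 (hKw i) (hs i hi').2
      refine ⟨L.map (Piece.map cellL), ?_, ?_, ?_, fun _ => ?_, fun h => absurd h hi⟩
      · rw [List.map_map]
        exact h1
      · intro p hp
        obtain ⟨p, hpL, rfl⟩ := List.mem_map.1 hp
        obtain ⟨g1, g2, g3, g4, g5, g6⟩ := h2 p hpL
        -- A piece in cell `c` has positive width, so its item ends strictly to the right of the
        -- start of group `c / M`, as `hfit` requires.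
        refine ⟨g1, g3.trans hγ1, g4.le.trans (hfit i hi' p.slot.divNat ?_)⟩
        have h4 : (p.slot.divNat * M : ℝ) ≤ p.slot := by
          have : (p.slot.divNat : ℕ) * M ≤ p.slot := Nat.div_mul_le_self _ _
          exact_mod_cast this
        have := mul_le_mul_of_nonneg_right h4 hγ0.le
        linarith
      · rw [List.pairwise_map]
        refine h3.imp fun {p p'} h hpp => ?_
        have : p.slot = p'.slot := hcellL hpp
        rw [this] at h
        simp only [Piece.map]
        linarith
      · intro p hp
        obtain ⟨p, hpL, rfl⟩ := List.mem_map.1 hp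
        obtain ⟨g1, g2, g3, g4, g5, g6⟩ := h2 p hpL
        exact ⟨p.slot, rfl, g5, g6⟩
  choose L hL1 hL2 hL3 hL4 hL5 using hpieces
  suffices h : ∃ P : ShelfPacking δ K (Fintype.card β), ∀ t, ∃ a,
      P.shelfHeight t = ht (Sum.inl a) by
    obtain ⟨P, hP⟩ := h
    exact ⟨P, fun t => by obtain ⟨a, ha⟩ := hP t; exact ⟨a.2.1, ha⟩⟩
  refine exists_shelfPacking_of_pieces (δ := δ) (K := K) bin bot ht
    (fun a => hH _) ?_ ?_ L hL1 hL2 hL3 ?_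
    (fun i hi p hp => by obtain ⟨c, hc, -⟩ := hL4 i hi p hp; exact ⟨_, hc⟩)
    (fun i hi p hp => by obtain ⟨c, hc, -⟩ := hL5 i hi p hp; exact ⟨_, hc⟩)
  · rintro (⟨t, a⟩ | ⟨t, a⟩)
    · exact ⟨(hy t a).1, (hy t a).2.trans (hbin t)⟩
    · exact ⟨add_nonneg (hf0 t) (by positivity), hrow ⟨t, a⟩⟩
  · rintro (⟨t, a⟩ | ⟨t, a⟩) (⟨t', a'⟩ | ⟨t', a'⟩) hne hb <;>
      obtain rfl : t = t' := (Fintype.equivFin β).injective hb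
    · exact hysep t a a' fun h => hne (by rw [h])
    · left
      change y t a + H a.1 ≤ f t + a' * η
      have : (0 : ℝ) ≤ a' * η := by positivity
      linarith [(hy t a).2]
    · right
      change y t a' + H a'.1 ≤ f t + a * η
      have : (0 : ℝ) ≤ a * η := by positivity
      linarith [(hy t a').2]
    · change f t + a * η + η ≤ f t + a' * η ∨ f t + a' * η + η ≤ f t + a * η
      have haa : (a : ℕ) ≠ a' := fun h => hne (by rw [Fin.ext h])
      rcases lt_or_gt_of_ne haa with h | h
      · have : (a + 1 : ℝ) ≤ a' := by exact_mod_cast h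
        left; nlinarith
      · have : (a' + 1 : ℝ) ≤ a := by exact_mod_cast h
        right; nlinarith
  · intro i i' hii p hp p' hp' hslot
    rcases le_or_gt (K i).height δ with hi | hi <;> rcases le_or_gt (K i').height δ with hi' | hi'
    · obtain ⟨c, hc, h1, h2⟩ := hL5 i hi p hp
      obtain ⟨c', hc', h1', h2'⟩ := hL5 i' hi' p' hp'
      obtain rfl : c = c' := hcellS (by rw [← hc, ← hc', hslot])
      rcases hzsep i (by simp [hSm, hi]) i' (by simp [hSm, hi']) hii with h | h
      · exact Or.inl (by linarith)
      · exact Or.inr (by linarith)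
    · obtain ⟨c, hc, -⟩ := hL5 i hi p hp
      obtain ⟨c', hc', -⟩ := hL4 i' hi' p' hp'
      rw [hc, hc'] at hslot
      exact absurd hslot Sum.inr_ne_inl
    · obtain ⟨c, hc, -⟩ := hL4 i hi p hp
      obtain ⟨c', hc', -⟩ := hL5 i' hi' p' hp'
      rw [hc, hc'] at hslot
      exact absurd hslot Sum.inl_ne_inr
    · obtain ⟨c, hc, h1, h2⟩ := hL4 i hi p hp
      obtain ⟨c', hc', h1', h2'⟩ := hL4 i' hi' p' hp'
      obtain rfl : c = c' := hcellL (by rw [← hc, ← hc', hslot])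
      rcases hsep i i' hi hi' hii with h | h
      · exact Or.inl (by linarith)
      · exact Or.inr (by linarith)

/-! ### Structured packings -/

/-- Carathéodory: a weighted family of vectors in `ℝ ^ r` can be replaced by a family of at most
`r + 1` of these vectors, with the same total weight and the same weighted sum. -/
theorem exists_small_columns {κ : Type*} [Fintype κ] {r : ℕ} (v : κ → Fin r → ℝ) (x : κ → ℝ)
    (hx : ∀ k, 0 ≤ x k) (hX : 0 < ∑ k, x k) :
    ∃ (κ' : Type) (_ : Fintype κ') (φ : κ' → κ) (y : κ' → ℝ), Fintype.card κ' ≤ r + 1 ∧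
      (∀ k, 0 < y k) ∧ ∑ k, y k = ∑ k, x k ∧
      ∀ j, ∑ k, y k * v (φ k) j = ∑ k, x k * v k j := by
  set X := ∑ k, x k with hXdef
  have hmem : ∑ k, (x k / X) • v k ∈ convexHull ℝ (Set.range v) := by
    refine (convex_convexHull ℝ _).sum_mem (fun k _ => div_nonneg (hx k) hX.le) ?_
      fun k _ => subset_convexHull ℝ _ ⟨k, rfl⟩
    rw [← Finset.sum_div, ← hXdef, div_self hX.ne']
  obtain ⟨κ', _, z, y, hz, hind, hy, hy1, hyz⟩ := eq_pos_convex_span_of_mem_convexHull hmem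
  choose φ hφ using fun k => hz ⟨k, rfl⟩
  refine ⟨κ', inferInstance, φ, fun k => X * y k, ?_, fun k => mul_pos hX (hy k), ?_, fun j => ?_⟩
  -- Carathéodory yields an affinely independent family, which in dimension `r` has at most `r + 1`
  -- members.
  · simpa using hind.card_le_finrank_succ.trans
      (Nat.succ_le_succ (Submodule.finrank_le (vectorSpan ℝ (Set.range z))))
  · rw [← Finset.mul_sum, hy1, mul_one]
  · have := congrFun hyz j
    simp only [Finset.sum_apply, Pi.smul_apply, smul_eq_mul] at this
    simp only [hφ, mul_assoc]
    rw [← Finset.mul_sum, this, Finset.mul_sum]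
    refine Finset.sum_congr rfl fun k _ => ?_
    field_simp

/-- Projection of `t` to the interval `[j g, (j + 1) g]`. -/
noncomputable def cellProj (g : ℝ) (j : ℕ) (t : ℝ) : ℝ := max (j * g) (min t ((j + 1) * g))

theorem cellProj_mono (g : ℝ) (j : ℕ) : Monotone (cellProj g j) := fun _ _ h =>
  max_le_max le_rfl (min_le_min h le_rfl)

theorem cellProj_of_le {g : ℝ} {j : ℕ} {t : ℝ} (h : t ≤ j * g) : cellProj g j t = j * g :=
  max_eq_left ((min_le_left _ _).trans h)

theorem cellProj_of_ge {g : ℝ} (hg : 0 ≤ g) {j : ℕ} {t : ℝ} (h : (j + 1) * g ≤ t) :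
    cellProj g j t = (j + 1) * g := by
  rw [cellProj, min_eq_right h, max_eq_right (by nlinarith)]

/-- The `j`-th term is the length of `[0, t]` inside the `j`-th cell. -/
theorem sum_cellProj {g : ℝ} (hg : 0 ≤ g) (r : ℕ) {t : ℝ} (ht : 0 ≤ t) :
    ∑ j : Fin r, (cellProj g j t - j * g) = min t (r * g) := by
  induction r with
  | zero => simp [ht]
  | succ r ih =>
    rw [Fin.sum_univ_castSucc]
    simp only [Fin.val_castSucc, Fin.val_last]
    rw [ih]
    push_cast
    rcases le_total t (r * g) with h | h
    · rw [cellProj_of_le h, min_eq_left h, min_eq_left (by nlinarith)]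
      ring
    · rw [min_eq_right h, cellProj, max_eq_right (le_min h (by nlinarith))]
      ring

/-- Linear grouping: rectangles whose heights can be placed vertically in `[0, 1]` so that every
level is covered with total width at most `W` have a structured fractional packing into few bins. -/
theorem exists_structured_packing {ι : Type*} [Fintype ι] {δ : ℝ} (hδ0 : 0 < δ)
    (K : ι → Rect) (hKw : ∀ i, 0 < (K i).width) (hKh : ∀ i, 0 < (K i).height)
    (a : ι → ℝ) (ha0 : ∀ i, 0 ≤ a i) (ha1 : ∀ i, a i + (K i).height ≤ 1) {W : ℝ} (hW : 0 ≤ W)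
    (hcov : ∀ y, ∑ i with y ∈ Set.Ioo (a i) (a i + (K i).height), (K i).width ≤ W) :
    ∃ (N : ℕ) (P : ShelfPacking δ K N), P.IsStructured ∧
      (N : ℝ) < W * (1 + δ) + ⌈1 / δ ^ 2⌉₊ + 1 + δ := by
  classical
  have hlt : ∀ i, a i < a i + (K i).height := fun i => by linarith [hKh i]
  have harea : ∑ i, (K i).width * (K i).height ≤ W := by
    refine weighted_sum_le_of_cover a (fun i => a i + (K i).height) _ _ W hW Finset.univ
      (fun i _ => hlt i) (fun i _ => ha0 i) (fun i _ => ha1 i) (fun i _ => (hKw i).le) hcov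
      fun c _ hc => ?_
    simpa using hc
  set Lg : Finset ι := Finset.univ.filter fun i => δ < (K i).height with hLg
  have hsplit : ∑ i ∈ Lg, (K i).width * (K i).height +
      ∑ i with (K i).height ≤ δ, (K i).width * (K i).height ≤ W := by
    refine le_trans (le_of_eq ?_) harea
    rw [← Finset.sum_filter_add_sum_filter_not Finset.univ (fun i => δ < (K i).height)]
    simp only [not_lt, hLg]
  rcases Lg.eq_empty_or_nonempty with hemp | ⟨i₀, hi₀⟩
  · -- only small items
    have hsm : ∀ i, ¬ δ < (K i).height := fun i hi => by
      have : i ∈ Lg := by simp [hLg, hi]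
      simp [hemp] at this
    rw [hemp, Finset.sum_empty, zero_add] at hsplit
    -- Without shelves only area matters, and `⌊W⌋₊ + 1` bins have area greater than `W`.
    obtain ⟨P, hP⟩ := exists_shelfPacking_of_counts (β := Fin (⌊W⌋₊ + 1)) (δ := δ) K hKw hKh 0 0
      Fin.elim0 (fun j => j.elim0) (fun _ => Fin.elim0) (by simp) (fun j => j.elim0) 1 one_pos
      le_rfl 0 (fun i hi => absurd hi (hsm i)) (fun i _ hi => absurd hi (hsm i))
      (fun i hi => absurd hi (hsm i))
      (by simpa using hsplit.trans_lt (Nat.lt_floor_add_one W))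
    refine ⟨_, P, ⟨?_, fun t => (hP t).choose.elim0⟩, ?_⟩
    · have : IsEmpty (Fin P.numShelves) := ⟨fun t => (hP t).choose.elim0⟩
      simp [Set.range_eq_empty]
    · have h1 := Nat.floor_le hW
      have h2 : (0 : ℝ) ≤ ⌈1 / δ ^ 2⌉₊ := Nat.cast_nonneg _
      simp only [Fintype.card_fin, Nat.cast_add, Nat.cast_one]
      nlinarith
  set Ω : ℝ := ∑ i ∈ Lg, (K i).width with hΩ
  have hΩ0 : 0 < Ω := Finset.sum_pos (fun i _ => hKw i) ⟨i₀, hi₀⟩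
  have hq1 : 1 ≤ ⌈1 / δ ^ 2⌉₊ := Nat.one_le_ceil_iff.2 (by positivity)
  have hqδ : 1 / δ ^ 2 ≤ (⌈1 / δ ^ 2⌉₊ : ℝ) := Nat.le_ceil _
  -- The first of the `r + 1` groups gets its own bins; the other `r` take the places of their
  -- predecessors in the columns.
  obtain ⟨r, hr⟩ : ∃ r, ⌈1 / δ ^ 2⌉₊ = r + 1 := ⟨_, (Nat.sub_add_cancel hq1).symm⟩
  rw [hr] at hqδ
  have hr0 : (0 : ℝ) < (r + 1 : ℕ) := by positivity
  set g : ℝ := Ω / (r + 1 : ℕ) with hg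
  have hg0 : 0 < g := div_pos hΩ0 hr0
  have hΩg : Ω = (r + 1 : ℕ) * g := by rw [hg]; field_simp
  -- A group of width `g` consists of exactly `M` cells of width `g / M ≤ 1`, one per shelf.
  set M : ℕ := ⌈g⌉₊ with hM
  have hM1 : 1 ≤ M := Nat.one_le_ceil_iff.2 hg0
  have hM0 : (0 : ℝ) < M := by exact_mod_cast hM1
  have hγ : (M : ℝ) * (g / M) = g := mul_div_cancel₀ _ hM0.ne'
  obtain ⟨s, hs, hsep, hpt, hdec, htel⟩ := exists_layout (fun i => (K i).width)
    (fun i => (K i).height) Lg fun i _ => (hKw i).le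
  -- the rounded heights
  have hpt' : ∀ j : Fin (r + 1), ∃ i ∈ Lg, s i ≤ j * g ∧ j * g < s i + (K i).width := fun j => by
    refine hpt _ (by positivity) ?_
    rw [← hΩ, hΩg]
    exact mul_lt_mul_of_pos_right (by exact_mod_cast j.2) hg0
  choose ι₀ hι hι1 hι2 using hpt'
  set H : Fin (r + 1) → ℝ := fun j => (K (ι₀ j)).height with hH
  have hH1 : ∀ j, H j ≤ 1 := fun j => by linarith [ha0 (ι₀ j), ha1 (ι₀ j)]
  have hHge : ∀ i ∈ Lg, ∀ j : Fin (r + 1), j * g < s i + (K i).width → (K i).height ≤ H j := by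
    intro i hi j hij
    by_cases hii : i = ι₀ j
    · rw [hii]
    · rcases hsep i hi _ (hι j) hii with h | h
      · linarith [hι1 j]
      · exact hdec _ (hι j) i hi (by linarith [hKw (ι₀ j)])
  -- This permits the shift: an item meeting group `j` starts before `(j + 1) * g`, so it is at
  -- least as tall as the shelf for group `j + 1` that replaces it.
  have hHle : ∀ i ∈ Lg, ∀ j : Fin (r + 1), s i < j * g → H j ≤ (K i).height := by
    intro i hi j hij
    by_cases hii : i = ι₀ j
    · rw [hii]
    · rcases hsep i hi _ (hι j) hii with h | h
      · exact hdec i hi _ (hι j) (by linarith [hKw i])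
      · linarith [hι2 j]
  -- the widths of the parts of the large items in the groups
  let ov : ι × Fin r → ℝ := fun p =>
    cellProj g p.2 (s p.1 + (K p.1).width) - cellProj g p.2 (s p.1)
  have hov0 : ∀ p, 0 ≤ ov p := fun p =>
    sub_nonneg.2 (cellProj_mono _ _ (by linarith [hKw p.1]))
  have hovlt : ∀ p, 0 < ov p → s p.1 < (p.2.succ : ℕ) * g := by
    intro p hp
    by_contra hle
    rw [not_lt, Fin.val_succ] at hle
    push_cast at hle
    have := hKw p.1
    simp only [ov] at hp
    rw [cellProj_of_ge hg0.le hle, cellProj_of_ge hg0.le (by linarith)] at hp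
    linarith
  have hovrow : ∀ i ∈ Lg, ∑ j, ov (i, j) ≤ (K i).width := by
    intro i hi
    have h0 := (hs i hi).1
    have hw := hKw i
    have : ∑ j, ov (i, j) = min (s i + (K i).width) (r * g) - min (s i) (r * g) := by
      rw [← sum_cellProj hg0.le r h0, ← sum_cellProj hg0.le r (by linarith),
        ← Finset.sum_sub_distrib]
      exact Finset.sum_congr rfl fun j _ => by simp [ov]
    rw [this]
    rcases le_total (s i) (r * g) with h | h
    · rw [min_eq_left h]
      linarith [min_le_left (s i + (K i).width) (r * g)]
    · rw [min_eq_right h]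
      linarith [min_le_right (s i + (K i).width) (r * g)]
  have hovcol : ∀ j : Fin r, ∑ i ∈ Lg, ov (i, j) = g := by
    intro j
    have hj : ((j : ℕ) + 1 : ℝ) ≤ (r + 1 : ℕ) := by
      exact_mod_cast Nat.succ_le_succ j.2.le
    rw [htel (cellProj g j), ← hΩ, hΩg,
      cellProj_of_ge hg0.le (mul_le_mul_of_nonneg_right hj hg0.le),
      cellProj_of_le (by positivity)]
    ring
  -- the fractional configurations
  set S : Finset (ι × Fin r) := (Lg ×ˢ Finset.univ).filter fun p => 0 < ov p with hS
  have hSL : ∀ p ∈ S, p.1 ∈ Lg ∧ 0 < ov p := fun p hp => by simpa [hS] using hp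
  -- The surplus `δ` makes the total weight of the columns positive and the final area estimate
  -- strict.
  have hScov : ∀ y, ∑ p ∈ S with y ∈ Set.Ioo (a p.1) (a p.1 + (K p.1).height), ov p ≤ W + δ := by
    intro y
    set Ly := Lg.filter fun i => y ∈ Set.Ioo (a i) (a i + (K i).height) with hLy
    calc _ ≤ ∑ p ∈ Ly ×ˢ Finset.univ, ov p := by
          refine Finset.sum_le_sum_of_subset_of_nonneg (fun p hp => ?_) fun p _ _ => hov0 p
          obtain ⟨hp, hy⟩ := Finset.mem_filter.1 hp
          simp only [hLy, Finset.mem_product, Finset.mem_univ, and_true]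
          exact Finset.mem_filter.2 ⟨(hSL p hp).1, hy⟩
      _ = ∑ i ∈ Ly, ∑ j, ov (i, j) := Finset.sum_product _ _ _
      _ ≤ ∑ i ∈ Ly, (K i).width :=
          Finset.sum_le_sum fun i hi => hovrow i (Finset.mem_filter.1 hi).1
      _ ≤ ∑ i with y ∈ Set.Ioo (a i) (a i + (K i).height), (K i).width :=
          Finset.sum_le_sum_of_subset_of_nonneg
            (Finset.filter_subset_filter _ (Finset.subset_univ _)) fun i _ _ => (hKw i).le
      _ ≤ W + δ := by linarith [hcov y]
  obtain ⟨κ, _, c, x, hx0, hcS, hdis, hsum, hcw⟩ := exists_interval_coloring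
    (fun p : ι × Fin r => a p.1) (fun p => a p.1 + (K p.1).height) ov (W + δ) (by linarith) S
    (fun p _ => hlt p.1) (fun p _ => hov0 p)
    fun p _ => cover_left_le_of_cover _ _ ov (W + δ) S (fun p _ => hov0 p) hScov _
  have hcfit : ∀ k, ∑ p ∈ c k, (K p.1).height ≤ 1 := fun k => by
    simpa using sum_length_le_of_disjoint (fun p : ι × Fin r => a p.1)
      (fun p => a p.1 + (K p.1).height) (c k) (fun p _ => hlt p.1) (fun p _ => ha0 p.1) (hdis k) 1
      zero_le_one fun p _ => ha1 p.1
  let n : κ → Fin r → ℕ := fun k j => ((c k).filter fun p => p.2 = j).card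
  have hnsum : ∀ (k : κ) (f : Fin r → ℝ), ∑ j, (n k j : ℝ) * f j = ∑ p ∈ c k, f p.2 := by
    intro k f
    rw [← Finset.sum_fiberwise (c k) (fun p => p.2) fun p => f p.2]
    refine Finset.sum_congr rfl fun j _ => ?_
    rw [Finset.sum_congr rfl fun p hp => by rw [(Finset.mem_filter.1 hp).2], Finset.sum_const,
      nsmul_eq_mul]
  have hHc : ∀ k, ∑ p ∈ c k, H p.2.succ ≤ ∑ p ∈ c k, (K p.1).height := fun k =>
    Finset.sum_le_sum fun p hp => by
      obtain ⟨h1, h2⟩ := hSL p (hcS k hp)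
      exact hHle p.1 h1 _ (hovlt p h2)
  -- The columns offer group `j` total width `g`, exactly what group `j + 1` needs.
  have hng : ∀ j, ∑ k, x k * (n k j : ℝ) = g := by
    intro j
    have h1 : ∀ k, (n k j : ℝ) = ∑ p ∈ c k, if p.2 = j then 1 else 0 := fun k => by
      simp [n]
    simp only [h1]
    rw [sum_columns S c x ov _ hcS hcw, hS, Finset.sum_filter_of_ne, Finset.sum_product]
    · simpa using hovcol j
    · exact fun p _ hp => lt_of_le_of_ne (hov0 p) fun h => hp (by rw [← h, zero_mul])
  obtain ⟨κ', _, φ, y, hcard, hy0, hysum, hyn⟩ := exists_small_columns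
    (fun k j => (n k j : ℝ)) x hx0 (by rw [hsum]; linarith)
  rw [hsum] at hysum
  simp only [hng] at hyn
  have hgH : ∑ j : Fin r, g * H j.succ ≤ ∑ i ∈ Lg, (K i).width * (K i).height := by
    calc ∑ j : Fin r, g * H j.succ = ∑ k, x k * ∑ p ∈ c k, H p.2.succ := by
          simp only [← hnsum _ fun j => H j.succ, Finset.mul_sum]
          rw [Finset.sum_comm]
          refine Finset.sum_congr rfl fun j _ => ?_
          rw [← hng j, Finset.sum_mul]
          exact Finset.sum_congr rfl fun k _ => by ring
      _ ≤ ∑ k, x k * ∑ p ∈ c k, (K p.1).height :=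
          Finset.sum_le_sum fun k _ => mul_le_mul_of_nonneg_left (hHc k) (hx0 k)
      _ = ∑ p ∈ S, ov p * (K p.1).height := sum_columns S c x ov _ hcS hcw
      _ ≤ ∑ p ∈ Lg ×ˢ Finset.univ, ov p * (K p.1).height :=
          Finset.sum_le_sum_of_subset_of_nonneg (Finset.filter_subset _ _)
            fun p _ _ => mul_nonneg (hov0 p) (hKh p.1).le
      _ = ∑ i ∈ Lg, (∑ j, ov (i, j)) * (K i).height := by
          rw [Finset.sum_product]
          exact Finset.sum_congr rfl fun i _ => by rw [Finset.sum_mul]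
      _ ≤ _ := Finset.sum_le_sum fun i hi => mul_le_mul_of_nonneg_right (hovrow i hi) (hKh i).le
  -- the bins
  let β := Fin M ⊕ Σ k : κ', Fin ⌈y k⌉₊
  -- The first `M` bins hold one shelf of height `H 0` each; the others are `⌈y k⌉₊` copies of each
  -- chosen column, with shelves of heights `H j.succ`.
  let cnt : β → Fin (r + 1) → ℕ :=
    Sum.elim (fun _ => Fin.cons 1 0) (fun t => Fin.cons 0 (n (φ t.1)))
  have hcnt1 : ∀ t, ∑ j, (cnt (Sum.inl t) j : ℝ) * H j = H 0 := fun t => by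
    simp [cnt, Fin.sum_univ_succ]
  have hcnt2 : ∀ t, ∑ j, (cnt (Sum.inr t) j : ℝ) * H j = ∑ j, (n (φ t.1) j : ℝ) * H j.succ :=
    fun t => by simp [cnt, Fin.sum_univ_succ]
  have hfitk : ∀ k, ∑ j, (n k j : ℝ) * H j.succ ≤ 1 := fun k => by
    rw [hnsum k fun j => H j.succ]
    exact (hHc k).trans (hcfit k)
  obtain ⟨P, hP⟩ := exists_shelfPacking_of_counts (β := β) (δ := δ) K hKw hKh (r + 1) M H
    (fun j => hKh _) cnt
    (by
      rintro (t | t)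
      · rw [hcnt1]; exact hH1 0
      · rw [hcnt2]; exact hfitk _)
    (by
      intro j
      rw [Fintype.sum_sum_type, Fintype.sum_sigma]
      refine Fin.cases ?_ (fun j => ?_) j
      · simp [cnt]
      · simp only [cnt, Sum.elim_inl, Sum.elim_inr, Fin.cons_succ, Pi.zero_apply,
          Finset.sum_const_zero, zero_add, Finset.sum_const, Finset.card_univ, Fintype.card_fin,
          smul_eq_mul]
        -- The number of shelves is an integer, so it reaches `M = ⌈g⌉₊` as soon as it is at least
        -- `g`.
        rw [hM, Nat.ceil_le, ← hyn j]
        push_cast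
        exact Finset.sum_le_sum fun k _ =>
          mul_le_mul_of_nonneg_right (Nat.le_ceil _) (Nat.cast_nonneg _))
    (g / M) (div_pos hg0 hM0) (div_le_one_of_le₀ (Nat.le_ceil _) hM0.le) s
    (fun i hi => by
      have := hs i (by simp [hLg, hi])
      rwa [Nat.cast_mul, mul_assoc, hγ, ← hΩg])
    (fun i i' hi hi' hii => hsep i (by simp [hLg, hi]) i' (by simp [hLg, hi']) hii)
    (fun i hi j hj => by
      rw [mul_assoc, hγ] at hj
      exact hHge i (by simp [hLg, hi]) j hj)
    (by
      rw [Fintype.sum_sum_type, Fintype.sum_sigma]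
      simp only [hcnt1, hcnt2, Finset.sum_const, Finset.card_univ, Fintype.card_fin, nsmul_eq_mul]
      -- The extra bins and the rounding only add free area. The unrounded columns already leave `W
      -- + δ` minus the shelf area, and by `hgH` that shelf area is at most the area of the large
      -- items.
      have h1 : 0 ≤ (M : ℝ) * (1 - H 0) := mul_nonneg hM0.le (by linarith [hH1 0])
      have h2 : ∑ k, y k * (1 - ∑ j, (n (φ k) j : ℝ) * H j.succ) ≤
          ∑ k, (⌈y k⌉₊ : ℝ) * (1 - ∑ j, (n (φ k) j : ℝ) * H j.succ) :=
        Finset.sum_le_sum fun k _ => mul_le_mul_of_nonneg_right (Nat.le_ceil _)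
          (by linarith [hfitk (φ k)])
      have h3 : ∑ k, y k * (1 - ∑ j, (n (φ k) j : ℝ) * H j.succ) =
          W + δ - ∑ j : Fin r, g * H j.succ := by
        simp only [mul_sub, mul_one, Finset.sum_sub_distrib, hysum, Finset.mul_sum]
        rw [Finset.sum_comm]
        congr 1
        refine Finset.sum_congr rfl fun j _ => ?_
        rw [← hyn j, Finset.sum_mul]
        exact Finset.sum_congr rfl fun k _ => by ring
      linarith)
  refine ⟨_, P, ⟨?_, fun t => ?_⟩, ?_⟩
  · have hsub : Set.range P.shelfHeight ⊆ (Finset.univ.image H : Finset ℝ) := by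
      rintro _ ⟨t, rfl⟩
      obtain ⟨j, hj⟩ := hP t
      rw [hj]
      simp
    refine (Set.ncard_le_ncard hsub (Finset.finite_toSet _)).trans ?_
    rw [Set.ncard_coe_finset, hr]
    exact Finset.card_image_le.trans (by simp)
  · obtain ⟨j, hj⟩ := hP t
    exact ⟨ι₀ j, (Finset.mem_filter.1 (hι j)).2, hj⟩
  · have h1 : (Fintype.card β : ℝ) = M + ∑ k, (⌈y k⌉₊ : ℝ) := by
      simp [β, Fintype.card_sigma]
    have h2 : (M : ℝ) < g + 1 := Nat.ceil_lt_add_one hg0.le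
    have h3 : ∑ k, (⌈y k⌉₊ : ℝ) ≤ W + δ + (r + 1 : ℕ) := by
      calc ∑ k, (⌈y k⌉₊ : ℝ) ≤ ∑ k, (y k + 1) :=
            Finset.sum_le_sum fun k _ => (Nat.ceil_lt_add_one (hy0 k).le).le
        _ = W + δ + Fintype.card κ' := by simp [Finset.sum_add_distrib, hysum]
        _ ≤ _ := by gcongr
    have h4 : δ * Ω ≤ W := by
      have : δ * Ω ≤ ∑ i ∈ Lg, (K i).width * (K i).height := by
        rw [hΩ, Finset.mul_sum]
        refine Finset.sum_le_sum fun i hi => ?_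
        rw [mul_comm]
        exact mul_le_mul_of_nonneg_left (Finset.mem_filter.1 hi).2.le (hKw i).le
      have h0 : 0 ≤ ∑ i with (K i).height ≤ δ, (K i).width * (K i).height :=
        Finset.sum_nonneg fun i _ => mul_nonneg (hKw i).le (hKh i).le
      linarith
    -- Since `r + 1 ≥ 1 / δ ^ 2`, `g = Ω / (r + 1) ≤ δ ^ 2 * Ω`, and `δ * Ω ≤ W`.
    have h5 : g ≤ δ * W := by
      rw [div_le_iff₀ (by positivity)] at hqδ
      rw [hg, div_le_iff₀ hr0]
      have h6 : δ * (δ * Ω) * (r + 1 : ℕ) ≤ δ * W * (r + 1 : ℕ) := by gcongr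
      nlinarith
    rw [h1, hr]
    linarith

theorem roundBox_width_pos {b k : ℕ} (hk : 3 ≤ k) {l : Fin (b + 1) → ℝ}
    (hl : ∀ j, l j ∈ Set.Ioc (0 : ℝ) 1) : 0 < (roundBox k l).width := by
  simp only [roundBox]
  exact Finset.prod_pos fun j _ => harmonicFn_pos hk (hl _)

theorem mainTheorem3 {ι : Type*} [Fintype ι] (b : ℕ) (hb : 1 ≤ b) (k : ℕ) (hk : 3 ≤ k)
    (δ : ℝ) (hδ : δ ∈ Set.Ioo (0 : ℝ) 1)
    (len : ι → Fin (b + 1) → ℝ) (hlen : ∀ i j, len i j ∈ Set.Ioc (0 : ℝ) 1) :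
    (∃ (N : ℕ) (P : ShelfPacking δ (fun i => roundBox k (len i)) N), P.IsStructured) ∧
      (sopt δ (fun i => roundBox k (len i)) : ℝ) <
        harmonicConst k ^ b * (1 + δ) * (optBP len : ℝ) + (⌈1 / δ ^ 2⌉₊ : ℝ) + 1 + δ := by
  classical
  obtain ⟨P⟩ : Nonempty (BoxPacking len (optBP len)) := Nat.sInf_mem (boxPacking_exists len hlen)
  obtain ⟨N, Q, hQ, hN⟩ := exists_structured_packing hδ.1 (fun i => roundBox k (len i))
    (fun i => roundBox_width_pos hk (hlen i))
    (fun i => (hlen i _).1) (fun i => P.pos i (Fin.last b)) (fun i => (P.inside i _).1)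
    (fun i => (P.inside i _).2)
    (W := harmonicConst k ^ b * optBP len)
    (mul_nonneg (pow_nonneg (harmonicConst_isLeast hk).1.1.le _) (Nat.cast_nonneg _))
    (roundBox_cover hk hlen P)
  refine ⟨⟨N, Q, hQ⟩, ?_⟩
  have hle : (sopt δ (fun i => roundBox k (len i)) : ℝ) ≤ N :=
    Nat.cast_le.2 (Nat.sInf_le (s := {N | ∃ P : ShelfPacking δ _ N, P.IsStructured}) ⟨Q, hQ⟩)
  linarith
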